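/- Let $k_1\le\dots\le k_n$ be positive integers. A domain (nonempty connected open set) $D\subset\mathbb C^n$ is called $(k_1,\dots,k_n)$-balanced if $(\lambda^{k_1}z_1,\dots,\lambda^{k_n}z_n)\in D$ for every $z\in D$ and every $\lambda\in\mathbb C$ with $|\lambda|\le1$. We say that $D$ can be exhausted by domains biholomorphic to convex domains if every compact subset of $D$ is contained in a domain $D'\subset D$ that is biholomorphic to a convex domain in $\mathbb C^n$ (this is the case, for instance, if $D$ is the union of an increasing sequence of such domains). Let $D\subset\mathbb C^n$ be a $(k_1,\dots,k_n)$-balanced domain which can be exhausted by domains biholomorphic to convex domains. If $2k_{m+1}>k_n$ for some $m$ with $0\le m\le n-1$, then the set $D_m=D\cap\{z_1=\dots=z_m=0\}$ is convex (where $D_m=D$ if $m=0$). In particular, every balanced domain in $\mathbb C^n$ (that is, $\lambda z\in D$ for all $z\in D$ and $|\lambda|\le1$) which can be exhausted by domains biholomorphic to convex domains is convex. -/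

import Mathlib

/-- A domain in `ℂⁿ`: a nonempty connected open set. -/
def IsComplexDomain {n : ℕ} (D : Set (Fin n → ℂ)) : Prop :=
  IsOpen D ∧ IsConnected D

/-- The weighted dilation `π_lam(z) = (lam ^ k₁ * z₁, …, lam ^ kₙ * zₙ)`. -/
def weightedDilation {n : ℕ} (k : Fin n → ℕ) (lam : ℂ) (z : Fin n → ℂ) : Fin n → ℂ :=
  fun j => lam ^ k j * z j

/-- `D` is `(k₁, …, kₙ)`-balanced: it is stable under `π_lam` for all `lam` in the closed
unit disc. -/
def IsWeightedBalanced {n : ℕ} (k : Fin n → ℕ) (D : Set (Fin n → ℂ)) : Prop :=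
  ∀ z ∈ D, ∀ lam : ℂ, ‖lam‖ ≤ 1 → weightedDilation k lam z ∈ D

/-- The sets `U` and `V` are biholomorphic: there are mutually inverse holomorphic maps
`F : U → V` and `H : V → U` (used for open `U` and `V`). -/
def AreBiholomorphic {n : ℕ} (U V : Set (Fin n → ℂ)) : Prop :=
  ∃ F H : (Fin n → ℂ) → (Fin n → ℂ),
    DifferentiableOn ℂ F U ∧ DifferentiableOn ℂ H V ∧
    Set.MapsTo F U V ∧ Set.MapsTo H V U ∧ Set.InvOn H F U V

/-- `U` is a domain in `ℂⁿ` that is biholomorphic to a convex domain in `ℂⁿ`. -/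
def IsBiholomorphicToConvex {n : ℕ} (U : Set (Fin n → ℂ)) : Prop :=
  IsComplexDomain U ∧
    ∃ G : Set (Fin n → ℂ), IsComplexDomain G ∧ Convex ℝ G ∧ AreBiholomorphic U G

/-- `D` can be exhausted by domains biholomorphic to convex domains: every compact subset of
`D` lies in a subdomain of `D` that is biholomorphic to a convex domain. -/
def IsExhaustedByBiholomorphicToConvex {n : ℕ} (D : Set (Fin n → ℂ)) : Prop :=
  ∀ K : Set (Fin n → ℂ), IsCompact K → K ⊆ D →
    ∃ U : Set (Fin n → ℂ), K ⊆ U ∧ U ⊆ D ∧ IsBiholomorphicToConvex U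

/-- The union of an increasing sequence of domains biholomorphic to convex domains is
exhausted by such domains in the above sense. -/
theorem isExhaustedByBiholomorphicToConvex_iUnion {n : ℕ} (U : ℕ → Set (Fin n → ℂ))
    (hmono : Monotone U) (hU : ∀ i, IsBiholomorphicToConvex (U i)) :
    IsExhaustedByBiholomorphicToConvex (⋃ i, U i) := by
  intro K hK hKU
  obtain ⟨i, hi⟩ := hK.elim_directed_cover U (fun i => (hU i).1.1) hKU hmono.directed_le
  exact ⟨U i, hi, Set.subset_iUnion U i, hU i⟩

/-! ### Taylor remainders, maximum principle and polytopes -/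

open Asymptotics Filter Metric Set Topology

/-! Write π_λ for the weighted dilation. Given p, q in D_m and c = a p + b q, choose U ⊆ D
containing all π_λ p and π_λ q with |λ| ≤ 1, and F : U → G biholomorphic onto a convex domain, with
inverse H. Put w(λ) = a F(π_λ p) + b F(π_λ q), which lies in G. With K = k_{m+1}, both dilates are
O(λ^K), and the derivatives of F at 0 and H at F(0) cancel, so H(w(λ)) = π_λ c + O(λ^{2K})
(`isBigO_comp_segment_sub_weightedDilation`). As every k_j < 2K, the disc f(λ) = π_{1/λ} H(w(λ))
extends holomorphically by f(0) = c. Its boundary lies in D because π_{1/λ} preserves D when |λ| =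
1.

It remains to fill in the disc (`IsExhaustedByBiholomorphicToConvex.mem_of_sphere_mem`): contract f
to the origin by π_s, 0 ≤ s ≤ 1, and run a continuity argument in s, where the maximum principle in
a convex model keeps the discs in a fixed compact set. -/

/-- The remainder of the first-order Taylor expansion of a complex differentiable map is
quadratic. -/
theorem DifferentiableOn.isBigO_sub_fderiv_sq {E F : Type*} [NormedAddCommGroup E]
    [NormedSpace ℂ E] [NormedAddCommGroup F] [NormedSpace ℂ F] {f : E → F} {U : Set E} {x : E}
    (hf : DifferentiableOn ℂ f U) (hU : U ∈ 𝓝 x) :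
    (fun y => f y - f x - fderiv ℂ f x (y - x)) =O[𝓝 x] (fun y => ‖y - x‖ ^ 2) := by
  have hx : DifferentiableAt ℂ f x := hf.differentiableAt hU
  set g : E → F := fun y => f y - f x - fderiv ℂ f x (y - x) with hg
  have hgx : g x = 0 := by simp [hg]
  have hgd : DifferentiableOn ℂ g U :=
    (hf.sub_const _).sub
      ((fderiv ℂ f x).differentiable.comp (differentiable_id.sub_const x)).differentiableOn
  have hgc : ContinuousAt g x := (hgd.differentiableAt hU).continuousAt
  have hev : ∀ᶠ y in 𝓝 x, y ∈ U ∧ g y ∈ closedBall (g x) 1 :=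
    (eventually_mem_set.2 hU).and (hgc (closedBall_mem_nhds _ one_pos))
  obtain ⟨r, hr, hball⟩ := Metric.eventually_nhds_iff_ball.1 hev
  refine IsBigO.of_bound (1 / r ^ 2) ?_
  filter_upwards [ball_mem_nhds x hr] with y hy
  have ho : (fun y => g y - g x) =o[𝓝 x] (fun y => ‖y - x‖ ^ 1) := by
    simpa [hgx, hg] using hx.hasFDerivAt.isLittleO.norm_right
  -- Higher-order Schwarz lemma: g maps the r-ball into the unit ball and is o(‖y - x‖), hence is at
  -- most (‖y - x‖ / r)².
  have := Complex.dist_le_mul_div_pow_of_mapsTo_ball_of_isLittleO (n := 1)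
    (hgd.mono fun y hy => (hball y hy).1) (fun y hy => (hball y hy).2) ho hy
  rw [hgx, dist_zero_right, dist_eq_norm] at this
  refine this.trans (le_of_eq ?_)
  rw [norm_pow, norm_norm]
  ring

/-- Maximum principle: a holomorphic map sends the disc into any closed convex set that contains
the image of the circle. -/
theorem DiffContOnCl.mem_of_sphere_mem {E : Type*} [NormedAddCommGroup E] [NormedSpace ℂ E]
    {u : ℂ → E} {C : Set E} (hu : DiffContOnCl ℂ u (ball 0 1)) (hC : Convex ℝ C)
    (hCc : IsClosed C) (hs : ∀ z ∈ sphere (0 : ℂ) 1, u z ∈ C) {z : ℂ}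
    (hz : z ∈ closedBall (0 : ℂ) 1) : u z ∈ C := by
  by_contra hzC
  obtain ⟨L, s, hL, hLz⟩ := RCLike.geometric_hahn_banach_closed_point (𝕜 := ℂ) hC hCc hzC
  -- The modulus of exp ∘ L ∘ u is exp (Re L(u)), so the maximum modulus principle bounds the
  -- separating real functional.
  have hd : DiffContOnCl ℂ (fun w => Complex.exp (L (u w))) (ball 0 1) :=
    (Complex.differentiable_exp.comp L.differentiable).comp_diffContOnCl hu
  have hle := Complex.norm_le_of_forall_mem_frontier_norm_le isBounded_ball hd
    (C := Real.exp s) (fun w hw => ?_) (z := z) (by rwa [closure_ball _ one_ne_zero])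
  · rw [Complex.norm_exp, Real.exp_le_exp] at hle
    exact absurd hle (not_le.2 hLz)
  · rw [frontier_ball _ one_ne_zero] at hw
    rw [Complex.norm_exp, Real.exp_le_exp]
    exact (hL _ (hs w hw)).le

theorem isBigO_pow_pow_nhds_zero {K l : ℕ} (h : K ≤ l) :
    (fun z : ℂ => z ^ l) =O[𝓝 0] (fun z : ℂ => z ^ K) := by
  refine IsBigO.of_bound 1 ?_
  filter_upwards [ball_mem_nhds (0 : ℂ) one_pos] with z hz
  rw [one_mul, norm_pow, norm_pow]
  exact pow_le_pow_of_le_one (norm_nonneg z) (mem_ball_zero_iff.1 hz).le h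

/-- In a finite-dimensional space, a polytope fits between a compact set and an open convex set
containing it. -/
theorem IsCompact.exists_finset_subset_convexHull_subset {E : Type*} [NormedAddCommGroup E]
    [NormedSpace ℝ E] [FiniteDimensional ℝ E] {C G : Set E} (hC : IsCompact C) (hG : IsOpen G)
    (hGc : Convex ℝ G) (hCG : C ⊆ G) :
    ∃ t : Finset E, C ⊆ convexHull ℝ (t : Set E) ∧ convexHull ℝ (t : Set E) ⊆ G := by
  classical
  have hloc : ∀ x ∈ C, ∃ u : Finset E, x ∈ interior (convexHull ℝ (u : Set E)) ∧
      convexHull ℝ (u : Set E) ⊆ G := fun x hx => by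
    obtain ⟨u, hu, huG⟩ :=
      (convex_singleton (𝕜 := ℝ) x).exists_subset_interior_convexHull_finset_of_isCompact
        isCompact_singleton (t := G) (by
          rw [nhdsSet_singleton]
          exact hG.mem_nhds (hCG hx))
    exact ⟨u, hu rfl, huG⟩
  choose! u hu huG using hloc
  obtain ⟨s, hsC, hs⟩ := hC.elim_nhds_subcover (fun x => interior (convexHull ℝ (u x : Set E)))
    fun x hx => isOpen_interior.mem_nhds (hu x hx)
  refine ⟨s.biUnion u, fun y hy => ?_, convexHull_min (fun y hy => ?_) hGc⟩
  · obtain ⟨x, hx, hyx⟩ := mem_iUnion₂.1 (hs hy)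
    exact convexHull_mono (Finset.coe_subset.2 (Finset.subset_biUnion_of_mem u hx))
      (interior_subset hyx)
  · obtain ⟨x, hx, hyx⟩ := Finset.mem_biUnion.1 (Finset.mem_coe.1 hy)
    exact huG x (hsC x hx) (subset_convexHull ℝ _ hyx)

/-! ### Weighted dilations -/

theorem differentiable_weightedDilation {n : ℕ} (k : Fin n → ℕ) (lam : ℂ) :
    Differentiable ℂ (weightedDilation k lam) := by
  unfold weightedDilation
  fun_prop

theorem differentiable_weightedDilation_left {n : ℕ} (k : Fin n → ℕ) (z : Fin n → ℂ) :
    Differentiable ℂ (fun lam => weightedDilation k lam z) := by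
  unfold weightedDilation
  fun_prop

theorem continuous_weightedDilation {n : ℕ} (k : Fin n → ℕ) :
    Continuous (fun x : ℂ × (Fin n → ℂ) => weightedDilation k x.1 x.2) := by
  unfold weightedDilation
  fun_prop

theorem weightedDilation_zero_left {n : ℕ} {k : Fin n → ℕ} (hk : ∀ j, 0 < k j)
    (z : Fin n → ℂ) : weightedDilation k 0 z = 0 := by
  funext j
  simp [weightedDilation, (hk j).ne']

theorem weightedDilation_one_left {n : ℕ} (k : Fin n → ℕ) (z : Fin n → ℂ) :
    weightedDilation k 1 z = z := by
  funext j
  simp [weightedDilation]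

/-- If the weighted dilates of `z` vanish in all coordinates of weight below `K`, then they are
`O(lam ^ K)` at the origin. -/
theorem isBigO_weightedDilation {n : ℕ} {k : Fin n → ℕ} {K : ℕ} {z : Fin n → ℂ}
    (hz : ∀ j, k j < K → z j = 0) :
    (fun lam => weightedDilation k lam z) =O[𝓝 0] (fun lam : ℂ => lam ^ K) := by
  refine isBigO_pi.2 fun j => ?_
  by_cases hj : k j < K
  · simpa [weightedDilation, hz j hj] using isBigO_zero _ _
  · have : (fun lam : ℂ => lam ^ k j) =O[𝓝 0] (fun lam : ℂ => lam ^ K) :=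
      isBigO_pow_pow_nhds_zero (not_lt.1 hj)
    simpa [weightedDilation, mul_comm] using this.const_mul_left (z j)

/-! ### Filling holomorphic discs -/

/-- A holomorphic disc whose boundary lies in a weighted balanced domain that is exhausted by
domains biholomorphic to convex ones lies in this domain. -/
theorem IsExhaustedByBiholomorphicToConvex.mem_of_sphere_mem {n : ℕ} {k : Fin n → ℕ}
    {D : Set (Fin n → ℂ)} (hk : ∀ j, 0 < k j) (hD : IsWeightedBalanced k D)
    (hex : IsExhaustedByBiholomorphicToConvex D) {f : ℂ → Fin n → ℂ}
    (hf : DifferentiableOn ℂ f (closedBall 0 1))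
    (hs : ∀ z ∈ sphere (0 : ℂ) 1, f z ∈ D) {z : ℂ} (hz : z ∈ closedBall (0 : ℂ) 1) :
    f z ∈ D := by
  have hfc : ContinuousOn f (closedBall 0 1) := hf.continuousOn
  have hdil : Continuous fun x : unitInterval × (Fin n → ℂ) =>
      weightedDilation k ((x.1 : ℝ) : ℂ) x.2 :=
    (continuous_weightedDilation k).comp
      (((Complex.continuous_ofReal.comp continuous_subtype_val).comp continuous_fst).prodMk
        continuous_snd)
  -- All contractions of the boundary circle at once, so that a single U serves every s.
  set K : Set (Fin n → ℂ) := (fun x : unitInterval × (Fin n → ℂ) =>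
      weightedDilation k ((x.1 : ℝ) : ℂ) x.2) '' (univ ×ˢ (f '' sphere 0 1))
  have hK : IsCompact K :=
    (isCompact_univ.prod ((isCompact_sphere 0 1).image_of_continuousOn
      (hfc.mono sphere_subset_closedBall))).image hdil
  have hKmem : ∀ (s : unitInterval), ∀ w ∈ sphere (0 : ℂ) 1,
      weightedDilation k ((s : ℝ) : ℂ) (f w) ∈ K := fun s w hw =>
    ⟨(s, f w), ⟨mem_univ _, mem_image_of_mem _ hw⟩, rfl⟩
  have hKD : K ⊆ D := by
    rintro _ ⟨⟨s, _⟩, ⟨-, w, hw, rfl⟩, rfl⟩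
    refine hD _ (hs w hw) _ ?_
    rw [Complex.norm_real, Real.norm_of_nonneg s.2.1]
    exact s.2.2
  obtain ⟨U, hKU, hUD, ⟨hUo, -⟩, G, ⟨hGo, -⟩, hGc, F, H, hF, hH, hFm, hHm, hinv⟩ := hex K hK hKD
  have hFK : IsCompact (F '' K) := hK.image_of_continuousOn (hF.continuousOn.mono hKU)
  obtain ⟨t, ht, hQG⟩ := hFK.exists_finset_subset_convexHull_subset hGo hGc
    (hFm.mono_left hKU).image_subset
  have hQc : IsCompact (convexHull ℝ (t : Set (Fin n → ℂ))) :=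
    t.finite_toSet.isCompact_convexHull ℝ
  set Q : Set (Fin n → ℂ) := H '' convexHull ℝ (t : Set (Fin n → ℂ))
  have hQ : IsCompact Q := hQc.image_of_continuousOn (hH.continuousOn.mono hQG)
  have hQU : Q ⊆ U := (hHm.mono_left hQG).image_subset
  -- A contracted disc inside U is already inside the compact Q, which does not depend on s: its
  -- F-image has boundary in the polytope, so the maximum principle applies.
  have key : ∀ s : unitInterval,
      (∀ w ∈ closedBall (0 : ℂ) 1, weightedDilation k ((s : ℝ) : ℂ) (f w) ∈ U) →
      ∀ w ∈ closedBall (0 : ℂ) 1, weightedDilation k ((s : ℝ) : ℂ) (f w) ∈ Q := by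
    intro s hsU w hw
    have hd : DifferentiableOn ℂ (fun w => weightedDilation k ((s : ℝ) : ℂ) (f w))
        (closedBall 0 1) :=
      (differentiable_weightedDilation k _).comp_differentiableOn hf
    have hu : DiffContOnCl ℂ (fun w => F (weightedDilation k ((s : ℝ) : ℂ) (f w))) (ball 0 1) :=
      DifferentiableOn.diffContOnCl (by
        rw [closure_ball _ one_ne_zero]
        exact hF.comp hd hsU)
    refine ⟨_, hu.mem_of_sphere_mem (convex_convexHull ℝ _) hQc.isClosed (fun w hw => ?_) hw,
      hinv.1 (hsU w hw)⟩
    exact ht (mem_image_of_mem F (hKmem s w hw))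
  have hjoint : ContinuousOn (fun x : unitInterval × ℂ =>
      weightedDilation k ((x.1 : ℝ) : ℂ) (f x.2)) (univ ×ˢ closedBall 0 1) :=
    hdil.comp_continuousOn (continuousOn_fst.prodMk
      (hfc.comp continuousOn_snd fun x hx => hx.2))
  set S : Set unitInterval :=
    {s | ∀ w ∈ closedBall (0 : ℂ) 1, weightedDilation k ((s : ℝ) : ℂ) (f w) ∈ U}
  have hSopen : IsOpen S := by
    rw [isOpen_iff_mem_nhds]
    intro s hsS
    refine (isCompact_closedBall (0 : ℂ) 1).eventually_forall_of_forall_eventually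
      (x₀ := s) (P := fun s w => w ∈ closedBall (0 : ℂ) 1 →
        weightedDilation k ((s : ℝ) : ℂ) (f w) ∈ U) (fun w hw => ?_) |>.mono
        fun s h w hw => h w hw hw
    have := (hjoint (s, w) ⟨mem_univ _, hw⟩).preimage_mem_nhdsWithin
      (hUo.mem_nhds (hsS w hw))
    rw [mem_nhdsWithin_iff_eventually] at this
    filter_upwards [this] with x hx hx'
    exact hx ⟨mem_univ _, hx'⟩
  -- By `key`, membership in the open set U may be replaced by membership in Q, a closed condition
  -- on s.
  have hSclosed : IsClosed S := by
    have : S = ⋂ w ∈ closedBall (0 : ℂ) 1,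
        {s : unitInterval | weightedDilation k ((s : ℝ) : ℂ) (f w) ∈ Q} := by
      ext s
      simp only [mem_iInter]
      exact ⟨fun h => key s h, fun h w hw => hQU (h w hw)⟩
    rw [this]
    exact isClosed_biInter fun w _ =>
      hQ.isClosed.preimage (hdil.comp (continuous_id.prodMk continuous_const))
  have h0S : (0 : unitInterval) ∈ S := by
    intro w _
    have := hKU (hKmem 0 1 (by simp))
    simp only [Set.Icc.coe_zero, Complex.ofReal_zero, weightedDilation_zero_left hk] at this ⊢
    exact this
  have h1S : (1 : unitInterval) ∈ S := by
    rw [IsClopen.eq_univ ⟨hSclosed, hSopen⟩ ⟨0, h0S⟩]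
    exact mem_univ _
  have := hUD (h1S z hz)
  simpa [weightedDilation_one_left] using this

/-! ### Second-order comparison and convexity -/

/-- Transporting a convex combination of two weighted discs through a biholomorphism changes it
only by a term of twice their vanishing order at the origin. -/
theorem isBigO_comp_segment_sub_weightedDilation {n : ℕ} {k : Fin n → ℕ} {K : ℕ}
    (hk : ∀ j, 0 < k j) {U G : Set (Fin n → ℂ)} (hU : IsOpen U) (hG : IsOpen G)
    (hU0 : (0 : Fin n → ℂ) ∈ U) {F H : (Fin n → ℂ) → (Fin n → ℂ)}
    (hF : DifferentiableOn ℂ F U) (hH : DifferentiableOn ℂ H G) (hFm : MapsTo F U G)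
    (hinv : LeftInvOn H F U) {p q : Fin n → ℂ} (hp : ∀ j, k j < K → p j = 0)
    (hq : ∀ j, k j < K → q j = 0) {a b : ℝ} (hab : a + b = 1) :
    (fun lam => H (a • F (weightedDilation k lam p) + b • F (weightedDilation k lam q)) -
      weightedDilation k lam (a • p + b • q)) =O[𝓝 0] (fun lam : ℂ => lam ^ (2 * K)) := by
  have hUn : U ∈ 𝓝 (0 : Fin n → ℂ) := hU.mem_nhds hU0
  have hGn : G ∈ 𝓝 (F 0) := hG.mem_nhds (hFm hU0)
  set A := fderiv ℂ F 0
  set B := fderiv ℂ H (F 0)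
  have hBA : ∀ v, B (A v) = v := by
    have h1 : HasFDerivAt (H ∘ F) (B.comp A) 0 :=
      (hH.differentiableAt hGn).hasFDerivAt.comp 0 (hF.differentiableAt hUn).hasFDerivAt
    have h2 : HasFDerivAt (H ∘ F) (ContinuousLinearMap.id ℂ (Fin n → ℂ)) 0 :=
      (hasFDerivAt_id _).congr_of_eventuallyEq (by
        filter_upwards [hUn] with y hy using hinv hy)
    intro v
    exact DFunLike.congr_fun (h1.unique h2) v
  have hdil0 : ∀ z, Tendsto (fun lam => weightedDilation k lam z) (𝓝 0) (𝓝 0) := fun z => by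
    have := (differentiable_weightedDilation_left k z).continuous.tendsto 0
    rwa [weightedDilation_zero_left hk] at this
  have hFexp : ∀ z : Fin n → ℂ, (∀ j, k j < K → z j = 0) →
      (fun lam => F (weightedDilation k lam z) - F 0 - A (weightedDilation k lam z)) =O[𝓝 0]
        (fun lam : ℂ => lam ^ (2 * K)) := by
    intro z hz
    have h1 := (hF.isBigO_sub_fderiv_sq hUn).comp_tendsto (hdil0 z)
    simp only [Function.comp_def, sub_zero] at h1
    refine h1.trans ?_
    -- The exponent 2K arises here: a quadratic remainder evaluated at a point of size O(λ^K).
    simpa only [← pow_mul, mul_comm K 2] using (isBigO_weightedDilation hz).norm_left.pow 2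
  set w : ℂ → Fin n → ℂ := fun lam =>
    a • F (weightedDilation k lam p) + b • F (weightedDilation k lam q) with hw
  set c : Fin n → ℂ := a • p + b • q with hc
  have hcK : ∀ j, k j < K → c j = 0 := fun j hj => by simp [hc, hp j hj, hq j hj]
  have hdilc : ∀ lam, weightedDilation k lam c =
      a • weightedDilation k lam p + b • weightedDilation k lam q := fun lam => by
    funext j
    simp only [weightedDilation, hc, Pi.add_apply, Pi.smul_apply, Complex.real_smul]
    ring
  have hwexp : (fun lam => w lam - F 0 - A (weightedDilation k lam c)) =O[𝓝 0]
      (fun lam : ℂ => lam ^ (2 * K)) := by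
    refine (((hFexp p hp).const_smul_left a).add ((hFexp q hq).const_smul_left b)).congr_left ?_
    intro lam
    have hF0 : F 0 = a • F 0 + b • F 0 := by rw [← add_smul, hab, one_smul]
    simp only [hw, hdilc, map_add, A.map_smul_of_tower, Pi.smul_apply]
    nth_rewrite 3 [hF0]
    module
  have hpow : (fun lam : ℂ => lam ^ (2 * K)) =O[𝓝 0] (fun lam : ℂ => lam ^ K) :=
    isBigO_pow_pow_nhds_zero (by omega)
  have hwK : (fun lam => w lam - F 0) =O[𝓝 0] (fun lam : ℂ => lam ^ K) := by
    refine ((hwexp.trans hpow).add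
      ((A.isBigO_comp _ _).trans (isBigO_weightedDilation hcK))).congr_left fun lam => ?_
    simp
  have hwt : Tendsto w (𝓝 0) (𝓝 (F 0)) := by
    have hF0 : F 0 = a • F 0 + b • F 0 := by rw [← add_smul, hab, one_smul]
    have hFt : ∀ z, Tendsto (fun lam => F (weightedDilation k lam z)) (𝓝 0) (𝓝 (F 0)) :=
      fun z => (hF.differentiableAt hUn).continuousAt.tendsto.comp (hdil0 z)
    rw [hF0]
    exact ((hFt p).const_smul a).add ((hFt q).const_smul b)
  have hHexp : (fun lam => H (w lam) - H (F 0) - B (w lam - F 0)) =O[𝓝 0]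
      (fun lam : ℂ => lam ^ (2 * K)) := by
    refine ((hH.isBigO_sub_fderiv_sq hGn).comp_tendsto hwt).trans ?_
    simpa only [Function.comp_def, ← pow_mul, mul_comm K 2] using hwK.norm_left.pow 2
  refine (hHexp.add ((B.isBigO_comp _ _).trans hwexp)).congr_left fun lam => ?_
  rw [map_sub B (w lam - F 0), hBA, hinv hU0]
  simp [hw]

/-- In a weighted balanced domain exhausted by domains biholomorphic to convex ones, the points
that vanish in all coordinates of weight below `K` form a convex set, provided that all weights
are below `2 * K`. -/
theorem IsWeightedBalanced.convex_of_isExhausted {n : ℕ} {k : Fin n → ℕ} {K : ℕ}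
    {D : Set (Fin n → ℂ)} (hk : ∀ j, 0 < k j) (hD : IsWeightedBalanced k D)
    (hex : IsExhaustedByBiholomorphicToConvex D) (hK : ∀ j, k j < 2 * K) :
    Convex ℝ {z : Fin n → ℂ | z ∈ D ∧ ∀ j, k j < K → z j = 0} := by
  rintro p ⟨hpD, hp⟩ q ⟨hqD, hq⟩ a b ha hb hab
  refine ⟨?_, fun j hj => by simp [hp j hj, hq j hj]⟩
  set c : Fin n → ℂ := a • p + b • q with hc
  have hcont : ∀ z, Continuous fun lam => weightedDilation k lam z := fun z =>
    (differentiable_weightedDilation_left k z).continuous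
  obtain ⟨U, hCU, hUD, ⟨hUo, -⟩, G, ⟨hGo, -⟩, hGc, F, H, hF, hH, hFm, hHm, hinv⟩ :=
    hex ((fun lam => weightedDilation k lam p) '' closedBall 0 1 ∪
        (fun lam => weightedDilation k lam q) '' closedBall 0 1)
      (((isCompact_closedBall 0 1).image (hcont p)).union
        ((isCompact_closedBall 0 1).image (hcont q)))
      (by
        rintro _ (⟨lam, hl, rfl⟩ | ⟨lam, hl, rfl⟩)
        · exact hD _ hpD _ (by simpa using hl)
        · exact hD _ hqD _ (by simpa using hl))
  have hpU : ∀ lam ∈ closedBall (0 : ℂ) 1, weightedDilation k lam p ∈ U := fun lam hl =>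
    hCU (Or.inl ⟨lam, hl, rfl⟩)
  have hqU : ∀ lam ∈ closedBall (0 : ℂ) 1, weightedDilation k lam q ∈ U := fun lam hl =>
    hCU (Or.inr ⟨lam, hl, rfl⟩)
  have hU0 : (0 : Fin n → ℂ) ∈ U := by
    simpa [weightedDilation_zero_left hk] using hpU 0 (by simp)
  set W : Set ℂ := (fun lam => weightedDilation k lam p) ⁻¹' U ∩
    (fun lam => weightedDilation k lam q) ⁻¹' U
  have hW : IsOpen W := (hUo.preimage (hcont p)).inter (hUo.preimage (hcont q))
  have hball : closedBall 0 1 ⊆ W := fun lam hl => ⟨hpU lam hl, hqU lam hl⟩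
  have hW0 : W ∈ 𝓝 (0 : ℂ) := hW.mem_nhds (hball (by simp))
  set w : ℂ → Fin n → ℂ := fun lam =>
    a • F (weightedDilation k lam p) + b • F (weightedDilation k lam q) with hw
  have hwG : MapsTo w W G := fun lam hl => hGc (hFm hl.1) (hFm hl.2) ha hb hab
  have hwd : DifferentiableOn ℂ w W :=
    ((hF.comp (differentiable_weightedDilation_left k p).differentiableOn
      fun _ h => h.1).const_smul a).add
    ((hF.comp (differentiable_weightedDilation_left k q).differentiableOn
      fun _ h => h.2).const_smul b)
  have hgd : DifferentiableOn ℂ (fun lam => H (w lam)) W := hH.comp hwd hwG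
  have hbig := isBigO_comp_segment_sub_weightedDilation (K := K) hk hUo hGo hU0 hF hH hFm hinv.1
    hp hq hab
  -- The value at 0 is overwritten by c, the limit of the rescaled disc.
  set f : ℂ → Fin n → ℂ :=
    Function.update (fun lam => weightedDilation k lam⁻¹ (H (w lam))) 0 c with hf
  have hfne : ∀ lam : ℂ, lam ≠ 0 → f lam = weightedDilation k lam⁻¹ (H (w lam)) :=
    fun lam h => Function.update_of_ne h _ _
  have hfd : DifferentiableOn ℂ f (W \ {0}) := by
    have : DifferentiableOn ℂ (fun lam => weightedDilation k lam⁻¹ (H (w lam))) (W \ {0}) := by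
      refine differentiableOn_pi.2 fun j => ?_
      exact ((differentiableOn_inv.mono fun x hx => hx.2).pow (k j)).mul
        (differentiableOn_pi.1 (hgd.mono sdiff_subset) j)
    exact this.congr fun lam hl => hfne lam hl.2
  have hfcont : ContinuousAt f 0 := by
    rw [hf, continuousAt_update_same]
    refine tendsto_pi_nhds.2 fun j => ?_
    rw [← tendsto_sub_nhds_zero_iff]
    -- Coordinate j of f(λ) - c is λ^{-k_j} O(λ^{2K}), which tends to 0 since k_j < 2K.
    have h1 : (fun lam => (lam⁻¹) ^ k j * (H (w lam) - weightedDilation k lam c) j) =O[𝓝[≠] 0]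
        (fun lam : ℂ => (lam⁻¹) ^ k j * lam ^ (2 * K)) :=
      (isBigO_refl _ _).mul ((isBigO_pi.1 hbig j).mono nhdsWithin_le_nhds)
    have h2 : Tendsto (fun lam : ℂ => (lam⁻¹) ^ k j * lam ^ (2 * K)) (𝓝[≠] 0) (𝓝 0) := by
      have h3 : Tendsto (fun lam : ℂ => lam ^ (2 * K - k j)) (𝓝[≠] 0) (𝓝 0) := by
        have := (continuous_pow (M := ℂ) (2 * K - k j)).tendsto 0
        rw [zero_pow (Nat.sub_ne_zero_of_lt (hK j))] at this
        exact this.mono_left nhdsWithin_le_nhds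
      refine h3.congr' ?_
      filter_upwards [self_mem_nhdsWithin] with lam hl
      rw [pow_sub₀ _ hl (hK j).le, inv_pow, mul_comm]
    refine (h1.trans_tendsto h2).congr' ?_
    filter_upwards [self_mem_nhdsWithin] with lam hl
    have hl' : lam ^ k j ≠ 0 := pow_ne_zero _ hl
    simp only [weightedDilation, Pi.sub_apply, inv_pow]
    field_simp
  have hfW : DifferentiableOn ℂ f W :=
    (Complex.differentiableOn_compl_singleton_and_continuousAt_iff hW0).1 ⟨hfd, hfcont⟩
  have hfs : ∀ lam ∈ sphere (0 : ℂ) 1, f lam ∈ D := by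
    intro lam hl
    have hl1 : ‖lam‖ = 1 := by simpa using hl
    rw [hfne lam (norm_ne_zero_iff.1 (by simp [hl1]))]
    exact hD _ (hUD (hHm (hwG (hball (sphere_subset_closedBall hl))))) _ (by simp [hl1])
  have := hex.mem_of_sphere_mem hk hD (hfW.mono hball) hfs (z := 0) (by simp)
  simpa [hf] using this

theorem proposition2 (n : ℕ) :
    (∀ (k : Fin n → ℕ) (D : Set (Fin n → ℂ)) (m : ℕ) (hm : m < n),
      (∀ j, 0 < k j) → Monotone k →
      IsComplexDomain D → IsWeightedBalanced k D →
      IsExhaustedByBiholomorphicToConvex D →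
      k ⟨n - 1, by omega⟩ < 2 * k ⟨m, hm⟩ →
      Convex ℝ {z : Fin n → ℂ | z ∈ D ∧ ∀ j : Fin n, (j : ℕ) < m → z j = 0}) ∧
    (∀ D : Set (Fin n → ℂ),
      IsComplexDomain D → Balanced ℂ D → IsExhaustedByBiholomorphicToConvex D →
      Convex ℝ D) := by
  constructor
  · intro k D m hm hk hmono _ hD hex hlt p hp q hq a b ha hb hab
    -- With indices from 0, k ⟨m, hm⟩ is k_{m+1}. Ties in the weights may make the convex set of
    -- `convex_of_isExhausted` larger than D_m; one inclusion suffices, as the vanishing conditions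
    -- are linear.
    have hlow : ∀ j : Fin n, k j < k ⟨m, hm⟩ → (j : ℕ) < m := fun j hj => by
      by_contra h
      exact absurd (hmono (show (⟨m, hm⟩ : Fin n) ≤ j from not_lt.1 h)) (not_le.2 hj)
    have hconv := hD.convex_of_isExhausted (K := k ⟨m, hm⟩) hk hex fun j =>
      (hmono (show j ≤ ⟨n - 1, by omega⟩ from Nat.le_sub_one_of_lt j.2)).trans_lt hlt
    exact ⟨(hconv ⟨hp.1, fun j hj => hp.2 j (hlow j hj)⟩ ⟨hq.1, fun j hj => hq.2 j (hlow j hj)⟩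
      ha hb hab).1, fun j hj => by simp [hp.2 j hj, hq.2 j hj]⟩
  · intro D _ hD hex
    have hw : IsWeightedBalanced (fun _ => 1) D := fun z hz lam hl => by
      have : weightedDilation (fun _ => 1) lam z = lam • z := by
        funext j
        simp [weightedDilation]
      rw [this]
      exact hD.smul_mem hl hz
    -- No weight is below K = 1, so no coordinate is forced to vanish and the convex set is D
    -- itself.
    simpa using hw.convex_of_isExhausted (K := 1) (fun _ => one_pos) hex fun _ => by norm_num
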